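/- **Interactive lossless source coding.** Let $(X_{1},X_{2},X_{3})$ be a discrete memoryless source with finite alphabets $\mathcal X_1,\mathcal X_2,\mathcal X_3$ and joint pmf $p_{X_1X_2X_3}$; node $i\in\{1,2,3\}$ observes $X_i^n$. A $K$-step interactive code of length $n$ runs for $K\ge 1$ rounds. In every round the three nodes act one after the other, in a fixed order (the canonical one being $1\to2\to3$); in round $l$ node $i$ sends to the other two nodes a message from a finite set $\mathcal J_i^l$ that is a function of $X_i^n$ and of all messages sent before by the other two nodes. After round $K$, node $i$ forms, for each $j\ne i$, an estimate $\hat X_{ij}^n\in\mathcal X_j^n$ of $X_j^n$, as a function of $X_i^n$ and of all messages of the other two nodes. A vector $(R_1,R_2,R_3)\in\mathbb R^3$ is $K$-achievable if for every $\varepsilon>0$ there is $n_0$ such that for all $n>n_0$ there is a $K$-step interactive code of length $n$ with $$\frac1n\sum_{l=1}^K\log_2\|\mathcal J_i^l\|\le R_i+\varepsilon\quad(i=1,2,3),\qquad \Pr\big(\hat X_{ij}^n\ne X_j^n\big)\le\varepsilon\quad(i\neq j).$$ Then for every $K\ge1$ and every order of the nodes the set of $K$-achievable rate vectors is exactly the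 set of all $(R_1,R_2,R_3)$ with $$R_1\ge H(X_1|X_2X_3),\quad R_2\ge H(X_2|X_1X_3),\quad R_3\ge H(X_3|X_1X_2),$$ $$R_1+R_2\ge H(X_1X_2|X_3),\quad R_1+R_3\ge H(X_1X_3|X_2),\quad R_2+R_3\ge H(X_2X_3|X_1),$$ where entropies are in bits; equivalently, it is the closure of the set of rate vectors that satisfy these six inequalities strictly. In particular it does not depend on $K$, and it equals the set of rate vectors that are achievable (in the same sense) by standard Slepian–Wolf coding without interaction, where each node sends a single message that depends on its own source block only. -/

import Mathlib

open Set

noncomputable section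

namespace InteractiveLossless

/-- Probability of the event `E` under the pmf `q` on a finite set. -/
def prob {α : Type*} [Fintype α] (q : α → ℝ) (E : Set α) : ℝ :=
  ∑ a, E.indicator q a

/-- Conditional Shannon entropy (in bits) `H(U | V) = E[- log₂ P(U | V)]`, where `U` and `V` are
functions of a random element with pmf `q` on a finite set. Terms with `q a = 0` vanish, and both
probabilities are positive in all other terms. -/
def condEntropy {α β γ : Type*} [Fintype α] (q : α → ℝ) (U : α → β) (V : α → γ) : ℝ :=
  ∑ a, q a * -Real.logb 2 (prob q {b | U b = U a ∧ V b = V a} / prob q {b | V b = V a})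

/-- The law of `n` i.i.d. copies of a random element with pmf `p` (memoryless source). -/
def iidLaw {α : Type*} (p : α → ℝ) (n : ℕ) : (Fin n → α) → ℝ :=
  fun s => ∏ t, p (s t)

/-- The slot of node `a` in round `k` comes before the slot of node `i` in round `l`, if in every
round node `i` acts at position `σ i`. -/
def Before (σ : Equiv.Perm (Fin 3)) {K : ℕ} (a : Fin 3) (k : Fin K) (i : Fin 3) (l : Fin K) :
    Prop :=
  k < l ∨ (k = l ∧ σ a < σ i)

/-- A `K`-step interactive source code of block length `n` for three nodes with source alphabets
`𝒳 0`, `𝒳 1`, `𝒳 2`; in each round node `i` acts at position `σ i`. The reconstruction alphabets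
are the source alphabets. -/
structure Code (σ : Equiv.Perm (Fin 3)) (𝒳 : Fin 3 → Type*) (n K : ℕ) where
  /-- the size of the message set of node `i` in round `l` -/
  size : Fin 3 → Fin K → ℕ
  /-- the encoder of node `i` in round `l`: it sees the node's own source block and all messages
  sent so far by the other two nodes -/
  enc : ∀ (i : Fin 3) (l : Fin K), (Fin n → 𝒳 i) →
    (∀ q : {q : Fin 3 × Fin K // q.1 ≠ i ∧ Before σ q.1 q.2 i l}, Fin (size q.1.1 q.1.2)) →
    Fin (size i l)
  /-- the reconstruction at node `i` of the source block of node `j` -/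
  dec : ∀ i j : Fin 3, i ≠ j → (Fin n → 𝒳 i) →
    (∀ q : {q : Fin 3 × Fin K // q.1 ≠ i}, Fin (size q.1.1 q.1.2)) → (Fin n → 𝒳 j)

namespace Code

variable {σ : Equiv.Perm (Fin 3)} {𝒳 : Fin 3 → Type*} {n K : ℕ}

/-- The message that node `i` sends in round `l` when the source block is `s`
(`s t i` is the letter of source `i` at time `t`). -/
def msg (c : Code σ 𝒳 n K) (s : Fin n → ∀ i, 𝒳 i) (i : Fin 3) (l : Fin K) : Fin (c.size i l) :=
  c.enc i l (fun t => s t i) (fun q => c.msg s q.1.1 q.1.2)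
termination_by (l.val, (σ i).val)
decreasing_by
  rcases q.2.2 with h | ⟨h, h'⟩
  · exact Prod.Lex.left _ _ h
  · rw [h]
    exact Prod.Lex.right _ h'

/-- The reconstruction by node `i` of the source block of node `j`. -/
def recon (c : Code σ 𝒳 n K) (s : Fin n → ∀ i, 𝒳 i) (i j : Fin 3) (h : i ≠ j) : Fin n → 𝒳 j :=
  c.dec i j h (fun t => s t i) (fun q => c.msg s q.1.1 q.1.2)

/-- The total rate of node `i`, in bits per source letter. -/
def rate (c : Code σ 𝒳 n K) (i : Fin 3) : ℝ :=
  (1 / (n : ℝ)) * ∑ l, Real.logb 2 (c.size i l)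

/-- The probability that node `i` does not reconstruct the source block of node `j` exactly. -/
def errProb [∀ i, Fintype (𝒳 i)] (c : Code σ 𝒳 n K) (p : (∀ i, 𝒳 i) → ℝ) (i j : Fin 3)
    (h : i ≠ j) : ℝ :=
  prob (iidLaw p n) {s | c.recon s i j h ≠ fun t => s t j}

end Code

/-- Rate vectors achievable with `K` rounds, for lossless reconstruction of all sources at all
nodes. -/
def interactiveRegion (σ : Equiv.Perm (Fin 3)) {𝒳 : Fin 3 → Type*} [∀ i, Fintype (𝒳 i)]
    (p : (∀ i, 𝒳 i) → ℝ) (K : ℕ) : Set (Fin 3 → ℝ) :=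
  {R | ∀ ε : ℝ, 0 < ε → ∃ n₀ : ℕ, ∀ n : ℕ, n₀ < n → ∃ c : Code σ 𝒳 n K,
    (∀ i, c.rate i ≤ R i + ε) ∧ ∀ (i j : Fin 3) (h : i ≠ j), c.errProb p i j h ≤ ε}

/-- A code without interaction (of Slepian–Wolf type): every node sends a single message that
depends on its own source block only. -/
structure SWCode (𝒳 : Fin 3 → Type*) (n : ℕ) where
  /-- the size of the message set of node `i` -/
  size : Fin 3 → ℕ
  /-- the encoder of node `i` -/
  enc : ∀ i : Fin 3, (Fin n → 𝒳 i) → Fin (size i)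
  /-- the reconstruction at node `i` of the source block of node `j` -/
  dec : ∀ i j : Fin 3, i ≠ j → (Fin n → 𝒳 i) → (∀ m : {m : Fin 3 // m ≠ i}, Fin (size m.1)) →
    (Fin n → 𝒳 j)

namespace SWCode

variable {𝒳 : Fin 3 → Type*} {n : ℕ}

/-- The reconstruction by node `i` of the source block of node `j`. -/
def recon (c : SWCode 𝒳 n) (s : Fin n → ∀ i, 𝒳 i) (i j : Fin 3) (h : i ≠ j) : Fin n → 𝒳 j :=
  c.dec i j h (fun t => s t i) (fun m => c.enc m.1 (fun t => s t m.1))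

/-- The rate of node `i`, in bits per source letter. -/
def rate (c : SWCode 𝒳 n) (i : Fin 3) : ℝ :=
  (1 / (n : ℝ)) * Real.logb 2 (c.size i)

/-- The probability that node `i` does not reconstruct the source block of node `j` exactly. -/
def errProb [∀ i, Fintype (𝒳 i)] (c : SWCode 𝒳 n) (p : (∀ i, 𝒳 i) → ℝ) (i j : Fin 3)
    (h : i ≠ j) : ℝ :=
  prob (iidLaw p n) {s | c.recon s i j h ≠ fun t => s t j}

end SWCode

/-- Rate vectors achievable without interaction, for lossless reconstruction of all sources at all
nodes. -/
def nonInteractiveRegion {𝒳 : Fin 3 → Type*} [∀ i, Fintype (𝒳 i)]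
    (p : (∀ i, 𝒳 i) → ℝ) : Set (Fin 3 → ℝ) :=
  {R | ∀ ε : ℝ, 0 < ε → ∃ n₀ : ℕ, ∀ n : ℕ, n₀ < n → ∃ c : SWCode 𝒳 n,
    (∀ i, c.rate i ≤ R i + ε) ∧ ∀ (i j : Fin 3) (h : i ≠ j), c.errProb p i j h ≤ ε}

end InteractiveLossless

end

noncomputable section

namespace InteractiveLossless

/-! ### Probability on a finite set -/

section Prob

variable {α : Type*} [Fintype α] {q : α → ℝ}

/-! Everything is phrased through one inequality, `setEntropy p A ≤ ∑ i ∈ A, R i`, for each nonempty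
proper set `A` of nodes; these are the six inequalities of the theorem. The regions are closed into
a cycle: interactive ⊆ inequalities ⊆ non-interactive ⊆ interactive. The last inclusion is sending
everything in round one and nothing afterwards.

Converse. Fix `i ∉ A`. Although messages depend on earlier messages, those of the nodes in `A`
together with the sources outside `A` determine all messages (`Code.msg_eq_of_agreeOff`), hence what
node `i` reconstructs. So, given the sources outside `A`, at most as many blocks are decoded
correctly as there are message tuples of `A`. By the weak law each of them typically has conditional
probability about `2 ^ (-n * setEntropy p A)`, so smaller total rates on `A` cannot cover
probability close to one (`Code.one_le_of_errProb_le`). No entropy calculus is needed.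

Achievability. Bin every source uniformly at random and decode to any block whose conditional
probabilities `blockRatio` are all not too small. A wrong candidate at node `i` differs from the
true block exactly on some nonempty `A` avoiding `i`. There are at most about `2 ^ (n * setEntropy p
A)` of these, each colliding with probability `1 / ∏ i ∈ A, M i`; averaging gives one good binning
(`exists_binning`). -/

theorem prob_nonneg (hq : ∀ a, 0 ≤ q a) (E : Set α) : 0 ≤ prob q E :=
  Finset.sum_nonneg fun a _ => Set.indicator_nonneg (fun a _ => hq a) a

/-- Inclusion is only required off the null points, where logarithms of probabilities are
meaningful. -/
theorem prob_mono_of_ne_zero (hq : ∀ a, 0 ≤ q a) {E F : Set α}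
    (h : ∀ a ∈ E, q a ≠ 0 → a ∈ F) : prob q E ≤ prob q F := by
  classical
  refine Finset.sum_le_sum fun a _ => ?_
  by_cases hE : a ∈ E
  · by_cases h0 : q a = 0
    · simp [Set.indicator_apply, h0]
    · simp [hE, h a hE h0]
  · simpa [hE] using Set.indicator_nonneg (fun a _ => hq a) a

theorem prob_mono (hq : ∀ a, 0 ≤ q a) {E F : Set α} (h : E ⊆ F) : prob q E ≤ prob q F :=
  prob_mono_of_ne_zero hq fun _ ha _ => h ha

theorem prob_union_le (hq : ∀ a, 0 ≤ q a) (E F : Set α) :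
    prob q (E ∪ F) ≤ prob q E + prob q F := by
  classical
  unfold prob
  rw [← Finset.sum_add_distrib]
  refine Finset.sum_le_sum fun a _ => ?_
  have := hq a
  by_cases hE : a ∈ E <;> by_cases hF : a ∈ F <;> simp [hE, hF, this]

theorem prob_empty : prob q ∅ = 0 := by simp [prob]

theorem prob_biUnion_le {κ : Type*} (hq : ∀ a, 0 ≤ q a) (S : Finset κ) (E : κ → Set α) :
    prob q (⋃ k ∈ S, E k) ≤ ∑ k ∈ S, prob q (E k) := by
  classical
  induction S using Finset.induction_on with
  | empty => simp [prob_empty]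
  | insert k S hk ih =>
    rw [Finset.sum_insert hk, Finset.set_biUnion_insert]
    exact (prob_union_le hq _ _).trans (by gcongr)

theorem prob_add_prob_compl (E : Set α) : prob q E + prob q Eᶜ = ∑ a, q a := by
  unfold prob
  rw [← Finset.sum_add_distrib]
  exact Finset.sum_congr rfl fun a _ => Set.indicator_self_add_compl_apply E q a

theorem le_prob (hq : ∀ a, 0 ≤ q a) {E : Set α} {a : α} (ha : a ∈ E) : q a ≤ prob q E := by
  have := Finset.single_le_sum (f := fun b => E.indicator q b)
    (fun b _ => Set.indicator_nonneg (fun a _ => hq a) b) (Finset.mem_univ a)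
  rwa [Set.indicator_of_mem ha] at this

theorem chebyshev (hq : ∀ a, 0 ≤ q a) (f : α → ℝ) {r : ℝ} (hr : 0 < r) :
    prob q {a | r ≤ |f a|} ≤ (∑ a, q a * f a ^ 2) / r ^ 2 := by
  classical
  rw [le_div_iff₀ (by positivity), prob, Finset.sum_mul]
  refine Finset.sum_le_sum fun a _ => ?_
  by_cases h : r ≤ |f a|
  · have : r ^ 2 ≤ f a ^ 2 := by rw [← sq_abs (f a)]; gcongr
    simpa [h] using mul_le_mul_of_nonneg_left this (hq a)
  · have := hq a
    simp only [mem_ofPred_eq, h, not_false_eq_true, indicator_of_notMem, zero_mul]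
    positivity

end Prob

/-! ### Memoryless sources and the weak law -/

section IID

theorem iidLaw_nonneg {α : Type*} {p : α → ℝ} (hp : ∀ a, 0 ≤ p a) (n : ℕ) (s : Fin n → α) : 0 ≤ iidLaw p n s :=
  Finset.prod_nonneg fun _ _ => hp _

variable {α : Type*} [Fintype α] {p : α → ℝ}

theorem sum_iidLaw (hp : ∑ a, p a = 1) (n : ℕ) : ∑ s, iidLaw p n s = 1 := by
  classical
  have := Fintype.prod_sum (fun (_ : Fin n) (a : α) => p a)
  simpa [iidLaw, hp] using this.symm

theorem sum_iidLaw_succ (n : ℕ) (F : (Fin (n + 1) → α) → ℝ) :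
    ∑ s, iidLaw p (n + 1) s * F s =
      ∑ a, ∑ s, p a * iidLaw p n s * F (Fin.cons a s) := by
  rw [← Fintype.sum_prod_type', ← (Fin.consEquiv fun _ : Fin (n + 1) => α).sum_comp]
  refine Finset.sum_congr rfl fun x _ => ?_
  simp [iidLaw, Fin.prod_univ_succ, Fin.consEquiv]

/-- Both moments go through one induction on `n`: expanding the square leaves a cross term, which
vanishes because `f` is centred. -/
theorem iidLaw_moments (hp : ∑ a, p a = 1) {f : α → ℝ} (hf : ∑ a, p a * f a = 0) (n : ℕ) :
    ∑ s, iidLaw p n s * ∑ t, f (s t) = 0 ∧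
      ∑ s, iidLaw p n s * (∑ t, f (s t)) ^ 2 = n * ∑ a, p a * f a ^ 2 := by
  induction n with
  | zero => simp
  | succ n ih =>
    obtain ⟨ih1, ih2⟩ := ih
    have h1 := sum_iidLaw hp n
    constructor
    · rw [sum_iidLaw_succ]
      have : ∀ a, ∑ s, p a * iidLaw p n s * ∑ t, f ((Fin.cons a s : Fin (n + 1) → α) t) =
          p a * f a * ∑ s, iidLaw p n s + p a * ∑ s, iidLaw p n s * ∑ t, f (s t) := by
        intro a
        rw [Finset.mul_sum, Finset.mul_sum, ← Finset.sum_add_distrib]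
        refine Finset.sum_congr rfl fun s _ => ?_
        rw [Fin.sum_univ_succ]
        simp only [Fin.cons_zero, Fin.cons_succ]
        ring
      simp only [this, ih1, h1, mul_one, mul_zero, add_zero, hf]
    · rw [sum_iidLaw_succ]
      have : ∀ a, ∑ s, p a * iidLaw p n s * (∑ t, f ((Fin.cons a s : Fin (n + 1) → α) t)) ^ 2 =
          p a * f a ^ 2 * ∑ s, iidLaw p n s + 2 * p a * f a * ∑ s, iidLaw p n s * ∑ t, f (s t)
            + p a * ∑ s, iidLaw p n s * (∑ t, f (s t)) ^ 2 := by
        intro a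
        rw [Finset.mul_sum, Finset.mul_sum, Finset.mul_sum, ← Finset.sum_add_distrib,
          ← Finset.sum_add_distrib]
        refine Finset.sum_congr rfl fun s _ => ?_
        rw [Fin.sum_univ_succ]
        simp only [Fin.cons_zero, Fin.cons_succ]
        ring
      simp only [this, ih1, ih2, h1, mul_one, mul_zero, add_zero, Finset.sum_add_distrib]
      rw [← Finset.sum_mul, hp]
      push_cast
      ring

theorem weak_law (hp : p ∈ stdSimplex ℝ α) (f : α → ℝ) {δ : ℝ} (hδ : 0 < δ) :
    ∃ C : ℝ, ∀ n : ℕ, 0 < n →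
      prob (iidLaw p n) {s | n * δ ≤ |∑ t, f (s t) - n * ∑ a, p a * f a|} ≤ C / n := by
  set m := ∑ a, p a * f a with hm
  refine ⟨(∑ a, p a * (f a - m) ^ 2) / δ ^ 2, fun n hn => ?_⟩
  have hn' : (0 : ℝ) < n := by exact_mod_cast hn
  have h0 : ∑ a, p a * (f a - m) = 0 := by
    simp only [mul_sub, Finset.sum_sub_distrib, ← Finset.sum_mul, hp.2]
    simp [hm]
  have hc := chebyshev (iidLaw_nonneg hp.1 n) (fun s => ∑ t, (f (s t) - m))
    (mul_pos hn' hδ)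
  rw [(iidLaw_moments hp.2 h0 n).2] at hc
  simp only [Finset.sum_sub_distrib, Finset.sum_const, Finset.card_univ, Fintype.card_fin,
    nsmul_eq_mul] at hc
  refine hc.trans (le_of_eq ?_)
  field_simp

end IID

/-! ### Conditional probabilities and their concentration -/

section CondRatio

variable {ι : Type*} [Fintype ι] [DecidableEq ι] {𝒳 : ι → Type*} [∀ i, Fintype (𝒳 i)]
  {p : (∀ i, 𝒳 i) → ℝ}

/-- The marginal probability of the coordinates of `a` outside `A`. -/
def outerMarginal (p : (∀ i, 𝒳 i) → ℝ) (A : Finset ι) (a : ∀ i, 𝒳 i) : ℝ :=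
  prob p {b | ∀ i ∉ A, b i = a i}

/-- The conditional probability of `a`, given its coordinates outside `A`. -/
def condRatio (p : (∀ i, 𝒳 i) → ℝ) (A : Finset ι) (a : ∀ i, 𝒳 i) : ℝ :=
  p a / outerMarginal p A a

/-- The conditional entropy of the coordinates in `A`, given those outside `A`. -/
def setEntropy (p : (∀ i, 𝒳 i) → ℝ) (A : Finset ι) : ℝ :=
  ∑ a, p a * -Real.logb 2 (condRatio p A a)

theorem le_outerMarginal (hp : ∀ a, 0 ≤ p a) (A : Finset ι) (a : ∀ i, 𝒳 i) :
    p a ≤ outerMarginal p A a :=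
  le_prob hp (by simp)

theorem outerMarginal_nonneg (hp : ∀ a, 0 ≤ p a) (A : Finset ι) (a : ∀ i, 𝒳 i) :
    0 ≤ outerMarginal p A a := prob_nonneg hp _

theorem condRatio_nonneg (hp : ∀ a, 0 ≤ p a) (A : Finset ι) (a : ∀ i, 𝒳 i) :
    0 ≤ condRatio p A a := div_nonneg (hp a) (outerMarginal_nonneg hp A a)

theorem condRatio_le_one (hp : ∀ a, 0 ≤ p a) (A : Finset ι) (a : ∀ i, 𝒳 i) :
    condRatio p A a ≤ 1 :=
  div_le_one_of_le₀ (le_outerMarginal hp A a) (outerMarginal_nonneg hp A a)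

theorem condRatio_pos (hp : ∀ a, 0 ≤ p a) (A : Finset ι) {a : ∀ i, 𝒳 i} (ha : p a ≠ 0) :
    0 < condRatio p A a := by
  have : 0 < p a := lt_of_le_of_ne (hp a) ha.symm
  exact div_pos this (this.trans_le (le_outerMarginal hp A a))

theorem condRatio_mul_outerMarginal (hp : ∀ a, 0 ≤ p a) (A : Finset ι) (a : ∀ i, 𝒳 i) :
    condRatio p A a * outerMarginal p A a = p a := by
  by_cases h : outerMarginal p A a = 0
  · have := le_outerMarginal hp A a
    rw [h, mul_zero]
    exact le_antisymm (hp a) (h ▸ this)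
  · exact div_mul_cancel₀ _ h

theorem setEntropy_nonneg (hp : ∀ a, 0 ≤ p a) (A : Finset ι) : 0 ≤ setEntropy p A := by
  refine Finset.sum_nonneg fun a _ => mul_nonneg (hp a) ?_
  rw [neg_nonneg]
  exact Real.logb_nonpos one_lt_two (condRatio_nonneg hp A a) (condRatio_le_one hp A a)

-- The outer marginal is constant on the fibre, so the sum is that marginal divided by itself; only
-- `≤` holds because the quotient is `0` when the marginal vanishes.
open Classical in
theorem sum_condRatio_le_one (p : (∀ i, 𝒳 i) → ℝ) (A : Finset ι) (a : ∀ i, 𝒳 i) :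
    ∑ b, (if ∀ i ∉ A, b i = a i then condRatio p A b else 0) ≤ 1 := by
  have h : ∀ b, (if ∀ i ∉ A, b i = a i then condRatio p A b else 0) =
      {b | ∀ i ∉ A, b i = a i}.indicator p b / outerMarginal p A a := by
    intro b
    by_cases hb : ∀ i ∉ A, b i = a i
    · rw [if_pos hb, Set.indicator_of_mem (by exact hb), condRatio]
      have : {c : ∀ i, 𝒳 i | ∀ i ∉ A, c i = b i} = {c | ∀ i ∉ A, c i = a i} := by
        ext c
        exact forall₂_congr fun i hi => by rw [hb i hi]
      rw [outerMarginal, outerMarginal, this]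
    · rw [if_neg hb, Set.indicator_of_notMem (by exact hb), zero_div]
  simp only [h, ← Finset.sum_div]
  exact div_self_le_one _

/-- The conditional probability of the block `s`, given its coordinates outside `A`. -/
def blockRatio (p : (∀ i, 𝒳 i) → ℝ) (A : Finset ι) {n : ℕ} (s : Fin n → ∀ i, 𝒳 i) : ℝ :=
  ∏ t, condRatio p A (s t)

/-- Null blocks are excluded because `Real.logb 2 0 = 0`. -/
theorem blockRatio_eq_rpow (hp : ∀ a, 0 ≤ p a) (A : Finset ι) {n : ℕ} {s : Fin n → ∀ i, 𝒳 i}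
    (hs : iidLaw p n s ≠ 0) :
    blockRatio p A s = (2 : ℝ) ^ (-∑ t, -Real.logb 2 (condRatio p A (s t))) := by
  have h : ∀ t, 0 < condRatio p A (s t) := fun t =>
    condRatio_pos hp A (Finset.prod_ne_zero_iff.1 hs t (Finset.mem_univ t))
  rw [Finset.sum_neg_distrib, neg_neg, ← Real.logb_prod _ _ fun t _ => (h t).ne',
    Real.rpow_logb two_pos (by norm_num) (Finset.prod_pos fun t _ => h t)]
  rfl

theorem prob_blockRatio_deviation (hp : p ∈ stdSimplex ℝ (∀ i, 𝒳 i)) (A : Finset ι) {δ : ℝ}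
    (hδ : 0 < δ) : ∃ C : ℝ, ∀ n : ℕ, 0 < n →
      prob (iidLaw p n) {s | blockRatio p A s < (2 : ℝ) ^ (-(n * (setEntropy p A + δ)))} ≤ C / n ∧
      prob (iidLaw p n) {s | (2 : ℝ) ^ (-(n * (setEntropy p A - δ))) < blockRatio p A s}
        ≤ C / n := by
  obtain ⟨C, hC⟩ := weak_law hp (fun a => -Real.logb 2 (condRatio p A a)) hδ
  refine ⟨C, fun n hn => ⟨(prob_mono_of_ne_zero (iidLaw_nonneg hp.1 n) ?_).trans (hC n hn),
    (prob_mono_of_ne_zero (iidLaw_nonneg hp.1 n) ?_).trans (hC n hn)⟩⟩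
  · intro s hs h0
    rw [mem_ofPred_eq, blockRatio_eq_rpow hp.1 A h0, Real.rpow_lt_rpow_left_iff one_lt_two] at hs
    rw [mem_ofPred_eq]
    refine le_trans ?_ (le_abs_self _)
    change _ ≤ _ - n * setEntropy p A
    linarith
  · intro s hs h0
    rw [mem_ofPred_eq, blockRatio_eq_rpow hp.1 A h0, Real.rpow_lt_rpow_left_iff one_lt_two] at hs
    rw [mem_ofPred_eq]
    refine le_trans ?_ (neg_le_abs _)
    change _ ≤ -(_ - n * setEntropy p A)
    linarith

end CondRatio

/-! ### Counting blocks in a fibre -/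

section Block

variable {ι : Type*} {𝒳 : ι → Type*} {n : ℕ}

/-- The blocks `s` and `s'` have the same coordinates outside `A`. -/
def AgreeOff (A : Finset ι) (s s' : Fin n → ∀ i, 𝒳 i) : Prop :=
  ∀ t, ∀ i ∉ A, s' t i = s t i

variable [Fintype ι] [DecidableEq ι] [∀ i, Fintype (𝒳 i)] {p : (∀ i, 𝒳 i) → ℝ}

open Classical in
theorem sum_blockRatio_le_one (hp : ∀ a, 0 ≤ p a) (A : Finset ι) (s : Fin n → ∀ i, 𝒳 i) :
    ∑ s', (if AgreeOff A s s' then blockRatio p A s' else 0) ≤ 1 := by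
  have h : ∀ s', (if AgreeOff A s s' then blockRatio p A s' else 0) =
      ∏ t, if ∀ i ∉ A, s' t i = s t i then condRatio p A (s' t) else 0 := fun s' => by
    by_cases h : AgreeOff A s s'
    · rw [if_pos h]
      exact Finset.prod_congr rfl fun t _ => (if_pos (h t)).symm
    · rw [if_neg h]
      obtain ⟨t, ht⟩ := not_forall.1 h
      exact (Finset.prod_eq_zero (Finset.mem_univ t) (if_neg ht)).symm
  simp only [h, ← Fintype.prod_sum
    fun (t : Fin n) (b : ∀ i, 𝒳 i) => if ∀ i ∉ A, b i = s t i then condRatio p A b else 0]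
  refine Finset.prod_le_one (fun t _ => ?_) fun t _ => sum_condRatio_le_one p A (s t)
  refine Finset.sum_nonneg fun b _ => ?_
  split_ifs
  exacts [condRatio_nonneg hp A b, le_rfl]

-- The conditional probabilities on a fibre sum to at most one, so at most `θ⁻¹` of them reach `θ`.
open Classical in
theorem card_blockRatio_ge_le (hp : ∀ a, 0 ≤ p a) (A : Finset ι) (s : Fin n → ∀ i, 𝒳 i)
    {θ : ℝ} (hθ : 0 < θ) :
    ((Finset.univ.filter fun s' => AgreeOff A s s' ∧ θ ≤ blockRatio p A s').card : ℝ) ≤ θ⁻¹ := by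
  rw [← one_div, le_div_iff₀ hθ]
  refine le_trans ?_ (sum_blockRatio_le_one hp A s)
  rw [← nsmul_eq_mul, ← Finset.sum_const, Finset.sum_filter]
  refine Finset.sum_le_sum fun s' _ => ?_
  have : 0 ≤ blockRatio p A s' := Finset.prod_nonneg fun t _ => condRatio_nonneg hp A _
  split_ifs with h1 h2 h2
  exacts [h1.2, absurd h1.1 h2, this, le_rfl]

open Classical in
theorem prod_outerMarginal (p : (∀ i, 𝒳 i) → ℝ) (A : Finset ι) (s : Fin n → ∀ i, 𝒳 i) :
    ∏ t, outerMarginal p A (s t) = ∑ s', if AgreeOff A s s' then iidLaw p n s' else 0 := by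
  have h : ∀ s', (if AgreeOff A s s' then iidLaw p n s' else 0) =
      ∏ t, if ∀ i ∉ A, s' t i = s t i then p (s' t) else 0 := fun s' => by
    by_cases h : AgreeOff A s s'
    · rw [if_pos h]
      exact Finset.prod_congr rfl fun t _ => (if_pos (h t)).symm
    · rw [if_neg h]
      obtain ⟨t, ht⟩ := not_forall.1 h
      exact (Finset.prod_eq_zero (Finset.mem_univ t) (if_neg ht)).symm
  simp only [h, ← Fintype.prod_sum
    fun (t : Fin n) (b : ∀ i, 𝒳 i) => if ∀ i ∉ A, b i = s t i then p b else 0]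
  refine Finset.prod_congr rfl fun t _ => Finset.sum_congr rfl fun b _ => ?_
  simp [Set.indicator_apply]

/-- On each fibre `m` is injective on `E`, so `E` has at most `Fintype.card M` points there, and the
points counted have conditional probability at most `θ`. -/
theorem prob_blockRatio_le_inter (hp : p ∈ stdSimplex ℝ (∀ i, 𝒳 i)) (A : Finset ι)
    {M : Type*} [Fintype M] (m : (Fin n → ∀ i, 𝒳 i) → M) (E : Set (Fin n → ∀ i, 𝒳 i))
    (hE : ∀ s ∈ E, ∀ s' ∈ E, AgreeOff A s s' → m s = m s' → s = s') {θ : ℝ} (hθ : 0 ≤ θ) :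
    prob (iidLaw p n) (E ∩ {s | blockRatio p A s ≤ θ}) ≤ θ * Fintype.card M := by
  classical
  have hP := iidLaw_nonneg hp.1 n
  have h1 : prob (iidLaw p n) (E ∩ {s | blockRatio p A s ≤ θ}) ≤
      θ * ∑ s, if s ∈ E then ∏ t, outerMarginal p A (s t) else 0 := by
    rw [Finset.mul_sum]
    refine Finset.sum_le_sum fun s _ => ?_
    have hm : 0 ≤ ∏ t, outerMarginal p A (s t) :=
      Finset.prod_nonneg fun t _ => outerMarginal_nonneg hp.1 A _
    by_cases hs : s ∈ E
    · by_cases hr : blockRatio p A s ≤ θ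
      · have : iidLaw p n s = blockRatio p A s * ∏ t, outerMarginal p A (s t) := by
          rw [blockRatio, ← Finset.prod_mul_distrib]
          exact Finset.prod_congr rfl fun t _ => (condRatio_mul_outerMarginal hp.1 A _).symm
        rw [Set.indicator_of_mem (Set.mem_inter hs hr), this, if_pos hs]
        gcongr
      · rw [Set.indicator_of_notMem fun h => hr h.2, if_pos hs]
        positivity
    · rw [Set.indicator_of_notMem fun h => hs h.1, if_neg hs, mul_zero]
  refine h1.trans (mul_le_mul_of_nonneg_left ?_ hθ)
  simp only [prod_outerMarginal]
  -- Double counting: each `s'` is charged once for every point of `E` in its fibre.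
  rw [← Finset.sum_filter, Finset.sum_comm]
  have h2 : ∀ s', ∑ s ∈ Finset.univ.filter (· ∈ E), (if AgreeOff A s s' then iidLaw p n s' else 0)
      ≤ iidLaw p n s' * Fintype.card M := by
    intro s'
    rw [← Finset.sum_filter, Finset.sum_const, nsmul_eq_mul, mul_comm]
    refine mul_le_mul_of_nonneg_left ?_ (hP s')
    rw [← Finset.card_univ]
    norm_cast
    refine Finset.card_le_card_of_injOn m (fun _ _ => Finset.mem_coe.2 (Finset.mem_univ _)) ?_
    intro a ha b hb hab
    simp only [Finset.coe_filter, Finset.mem_filter, Finset.mem_univ, true_and,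
      mem_ofPred_eq] at ha hb
    exact hE a ha.1 b hb.1 (fun t i hi => (hb.2 t i hi).symm.trans (ha.2 t i hi)) hab
  refine (Finset.sum_le_sum fun s' _ => h2 s').trans ?_
  rw [← Finset.sum_mul, sum_iidLaw hp.2, one_mul]

end Block

/-! ### Converse for interactive codes -/

section Converse

variable {σ : Equiv.Perm (Fin 3)} {𝒳 : Fin 3 → Type*} {n K : ℕ}

/-- Recursion along the order of transmission: a node outside `A` sees the same source block and,
inductively, the same earlier messages. -/
theorem Code.msg_eq_of_agreeOff (c : Code σ 𝒳 n K) {A : Finset (Fin 3)}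
    {s s' : Fin n → ∀ i, 𝒳 i} (hs : AgreeOff A s s')
    (hm : ∀ i ∈ A, ∀ l, c.msg s i l = c.msg s' i l) (i : Fin 3) (l : Fin K) :
    c.msg s i l = c.msg s' i l := by
  by_cases hi : i ∈ A
  · exact hm i hi l
  · rw [Code.msg, Code.msg]
    have h1 : (fun t => s t i) = fun t => s' t i := funext fun t => (hs t i hi).symm
    rw [h1]
    congr 1
    funext q
    exact Code.msg_eq_of_agreeOff c hs hm q.1.1 q.1.2
termination_by (l.val, (σ i).val)
decreasing_by
  rcases q.2.2 with h | ⟨h, h'⟩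
  · exact Prod.Lex.left _ _ h
  · rw [h]
    exact Prod.Lex.right _ h'

theorem Code.eq_of_recon (c : Code σ 𝒳 n K) {A : Finset (Fin 3)} {i : Fin 3} (hi : i ∉ A)
    {s s' : Fin n → ∀ i, 𝒳 i} (hs : AgreeOff A s s')
    (hm : ∀ i ∈ A, ∀ l, c.msg s i l = c.msg s' i l)
    (h : ∀ j ∈ A, ∀ h : i ≠ j, c.recon s i j h = fun t => s t j)
    (h' : ∀ j ∈ A, ∀ h : i ≠ j, c.recon s' i j h = fun t => s' t j) : s = s' := by
  funext t j
  by_cases hj : j ∈ A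
  · have hij : i ≠ j := fun e => hi (e ▸ hj)
    have h1 : (fun t => s t i) = fun t => s' t i := funext fun t => (hs t i hi).symm
    have : c.recon s i j hij = c.recon s' i j hij := by
      rw [Code.recon, Code.recon, h1]
      congr 1
      funext q
      exact c.msg_eq_of_agreeOff hs hm _ _
    rw [h j hj hij, h' j hj hij] at this
    exact congrFun this t
  · exact (hs t j hj).symm

/-- The block `s` serves only to exhibit a message in every message set, so that no size is zero. -/
theorem Code.card_messages (c : Code σ 𝒳 n K) (hn : 0 < n) (s : Fin n → ∀ i, 𝒳 i)
    (A : Finset (Fin 3)) :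
    (Fintype.card (∀ (i : A) (l : Fin K), Fin (c.size i l)) : ℝ) =
      2 ^ (n * ∑ i ∈ A, c.rate i) := by
  have hpos : ∀ i l, (0 : ℝ) < c.size i l := fun i l => by
    exact_mod_cast (Nat.zero_le _).trans_lt (c.msg s i l).isLt
  have h : n * ∑ i ∈ A, c.rate i = Real.logb 2 (∏ i ∈ A, ∏ l, (c.size i l : ℝ)) := by
    rw [Real.logb_prod _ _ fun i _ => Finset.prod_ne_zero_iff.2 fun l _ => (hpos i l).ne',
      Finset.mul_sum]
    refine Finset.sum_congr rfl fun i _ => ?_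
    rw [Real.logb_prod _ _ fun l _ => (hpos i l).ne', Code.rate]
    field_simp
  rw [h, Real.rpow_logb two_pos (by norm_num)
    (Finset.prod_pos fun i _ => Finset.prod_pos fun l _ => hpos i l)]
  simp only [Fintype.card_pi, Fintype.card_fin]
  push_cast
  exact Finset.prod_coe_sort A fun i => ∏ l, (c.size i l : ℝ)

variable [∀ i, Fintype (𝒳 i)] {p : (∀ i, 𝒳 i) → ℝ}

/-- The whole space is split into decoding errors at node `i`, correctly decoded blocks with
`blockRatio` at most `θ`, and blocks above `θ`. -/
theorem Code.one_le_of_errProb_le (c : Code σ 𝒳 n K) (hn : 0 < n)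
    (hp : p ∈ stdSimplex ℝ (∀ i, 𝒳 i)) {A : Finset (Fin 3)} {i : Fin 3} (hi : i ∉ A) {ε : ℝ}
    (hε : 0 ≤ ε) (herr : ∀ j (h : i ≠ j), c.errProb p i j h ≤ ε) {θ : ℝ} (hθ : 0 ≤ θ) :
    1 ≤ 3 * ε + θ * 2 ^ (n * ∑ i ∈ A, c.rate i) +
      prob (iidLaw p n) {s | θ < blockRatio p A s} := by
  have hP := iidLaw_nonneg hp.1 n
  obtain ⟨s₀⟩ : Nonempty (∀ i, 𝒳 i) := by
    by_contra h
    rw [not_nonempty_iff] at h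
    simpa using hp.2
  set E : Set (Fin n → ∀ i, 𝒳 i) :=
    {s | ∀ j ∈ A, ∀ h : i ≠ j, c.recon s i j h = fun t => s t j} with hEdef
  have h1 : prob (iidLaw p n) Eᶜ ≤ 3 * ε := by
    let F : Fin 3 → Set (Fin n → ∀ i, 𝒳 i) :=
      fun j => {s | ∃ h : i ≠ j, c.recon s i j h ≠ fun t => s t j}
    have hF : ∀ j, prob (iidLaw p n) (F j) ≤ ε := by
      intro j
      by_cases h : i = j
      · have : F j = ∅ := by
          ext s
          simp [F, h]
        rw [this, prob_empty]
        exact hε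
      · exact (prob_mono hP fun s hs => hs.2).trans (herr j h)
    calc prob (iidLaw p n) Eᶜ ≤ prob (iidLaw p n) (⋃ j ∈ (Finset.univ : Finset (Fin 3)), F j) := by
          refine prob_mono hP fun s hs => ?_
          simp only [hEdef, mem_compl_iff, mem_ofPred_eq, not_forall] at hs
          obtain ⟨j, -, h, hs⟩ := hs
          simp only [mem_iUnion]
          exact ⟨j, Finset.mem_univ j, h, hs⟩
      _ ≤ ∑ j, prob (iidLaw p n) (F j) := prob_biUnion_le hP _ _
      _ ≤ ∑ j : Fin 3, ε := Finset.sum_le_sum fun j _ => hF j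
      _ = 3 * ε := by simp
  have h2 := prob_blockRatio_le_inter hp A
    (fun s (i : A) (l : Fin K) => c.msg s i l) E (fun s hs s' hs' hag hm =>
      c.eq_of_recon hi hag (fun i hi l => congrFun (congrFun hm ⟨i, hi⟩) l) hs hs') hθ
  rw [c.card_messages hn (fun _ => s₀) A] at h2
  have h3 : prob (iidLaw p n) E ≤ prob (iidLaw p n) (E ∩ {s | blockRatio p A s ≤ θ}) +
      prob (iidLaw p n) {s | θ < blockRatio p A s} := by
    refine (prob_mono hP fun s hs => ?_).trans (prob_union_le hP _ _)
    rcases le_or_gt (blockRatio p A s) θ with h | h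
    exacts [Or.inl ⟨hs, h⟩, Or.inr h]
  have h4 := prob_add_prob_compl (q := iidLaw p n) E
  rw [sum_iidLaw hp.2] at h4
  linarith

theorem tendsto_rpow_neg_mul_natCast {g : ℝ} (hg : 0 < g) :
    Filter.Tendsto (fun n : ℕ => (2 : ℝ) ^ (-(n * g))) Filter.atTop (nhds 0) := by
  have h : ∀ n : ℕ, (2 : ℝ) ^ (-(n * g)) = ((2 : ℝ) ^ (-g)) ^ n := fun n => by
    rw [← Real.rpow_mul_natCast two_pos.le]
    ring_nf
  simp only [h]
  exact tendsto_pow_atTop_nhds_zero_of_lt_one (by positivity)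
    (Real.rpow_lt_one_of_one_lt_of_neg one_lt_two (by linarith))

theorem setEntropy_le_of_mem_interactiveRegion (hp : p ∈ stdSimplex ℝ (∀ i, 𝒳 i))
    {R : Fin 3 → ℝ} (hR : R ∈ interactiveRegion σ p K) {A : Finset (Fin 3)}
    (hA : A ≠ Finset.univ) : setEntropy p A ≤ ∑ i ∈ A, R i := by
  by_contra! hlt
  obtain ⟨i, hi⟩ : ∃ i, i ∉ A := by
    by_contra! h
    exact hA (Finset.eq_univ_iff_forall.2 h)
  set g := setEntropy p A - ∑ i ∈ A, R i with hg
  have hg0 : 0 < g := by linarith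
  -- The exponent becomes `-g + g / 4 + 3 * (g / 8) = -(3 * g / 8)`, since `A` has at most three
  -- nodes. The cap `1 / 4` on the error leaves `3 / 4` plus a term below `1 / 4`, contradicting `1
  -- ≤`.
  obtain ⟨C, hC⟩ := prob_blockRatio_deviation hp A (δ := g / 4) (by positivity)
  obtain ⟨n₀, hn₀⟩ := hR (min (1 / 4) (g / 8)) (by positivity)
  have hlim : Filter.Tendsto (fun n : ℕ => (2 : ℝ) ^ (-(n * (3 * g / 8))) + C / n) Filter.atTop
      (nhds (0 + 0)) :=
    (tendsto_rpow_neg_mul_natCast (by positivity)).add (tendsto_const_div_atTop_nhds_zero_nat C)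
  rw [add_zero] at hlim
  obtain ⟨n, hn, hn1⟩ := ((hlim.eventually (gt_mem_nhds (show (0 : ℝ) < 1 / 4 by norm_num))).and
    (Filter.eventually_gt_atTop n₀)).exists
  have hnpos : 0 < n := (Nat.zero_le _).trans_lt hn1
  obtain ⟨c, hrate, herr⟩ := hn₀ n hn1
  have h1 := c.one_le_of_errProb_le hnpos hp hi (by positivity) (fun j h => herr i j h)
    (θ := (2 : ℝ) ^ (-(n * (setEntropy p A - g / 4)))) (by positivity)
  have h2 := (hC n hnpos).2
  have h3 : ∑ i ∈ A, c.rate i ≤ ∑ i ∈ A, R i + 3 * (g / 8) := by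
    calc ∑ i ∈ A, c.rate i ≤ ∑ i ∈ A, (R i + g / 8) :=
          Finset.sum_le_sum fun i _ => (hrate i).trans (by gcongr; exact min_le_right _ _)
      _ = ∑ i ∈ A, R i + A.card * (g / 8) := by simp [Finset.sum_add_distrib]
      _ ≤ _ := by
        gcongr
        exact_mod_cast (Finset.card_le_univ A).trans (by simp)
  have h4 : (2 : ℝ) ^ (-(n * (setEntropy p A - g / 4))) * 2 ^ (n * ∑ i ∈ A, c.rate i) ≤
      (2 : ℝ) ^ (-(n * (3 * g / 8))) := by
    rw [← Real.rpow_add two_pos, Real.rpow_le_rpow_left_iff one_lt_two]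
    have : n * ∑ i ∈ A, c.rate i ≤ n * (∑ i ∈ A, R i + 3 * (g / 8)) := by gcongr
    rw [hg] at this ⊢
    linarith
  have h5 : min (1 / 4) (g / 8) ≤ 1 / 4 := min_le_left _ _
  linarith

end Converse

/-! ### Achievability by random binning -/

section Binning

-- Counting form of collision probability `1 / ∏ i ∈ A, M i`. Overwriting a colliding `f i` at `x i`
-- by an arbitrary value loses nothing, because the old value can still be read off at `y i`.
open Classical in
theorem card_collision_mul_le {ι : Type*} [Fintype ι] [DecidableEq ι] {X : ι → Type*}
    [∀ i, Fintype (X i)] [∀ i, DecidableEq (X i)]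
    (M : ι → ℕ) (A : Finset ι) (x y : ∀ i, X i) (hxy : ∀ i ∈ A, y i ≠ x i) :
    (Finset.univ.filter fun f : ∀ i, X i → Fin (M i) => ∀ i ∈ A, f i (y i) = f i (x i)).card *
      ∏ i ∈ A, M i ≤ Fintype.card (∀ i, X i → Fin (M i)) := by
  have hM : ∏ i ∈ A, M i = (Finset.univ : Finset (∀ i : A, Fin (M i))).card := by
    rw [Finset.card_univ, Fintype.card_pi, ← Finset.prod_coe_sort A M]
    simp
  rw [hM, ← Finset.card_product, ← Finset.card_univ]
  refine Finset.card_le_card_of_injOn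
    (fun z i => if h : i ∈ A then Function.update (z.1 i) (x i) (z.2 ⟨i, h⟩) else z.1 i)
    (fun _ _ => Finset.mem_coe.2 (Finset.mem_univ _)) ?_
  rintro ⟨f, m⟩ hf ⟨g, m'⟩ hg h
  simp only [Finset.coe_product, Finset.coe_filter, Finset.mem_univ, true_and, Finset.coe_univ,
    Set.mem_prod, mem_ofPred_eq, mem_univ, and_true] at hf hg
  have hi : ∀ i, (if h : i ∈ A then Function.update (f i) (x i) (m ⟨i, h⟩) else f i) =
      if h : i ∈ A then Function.update (g i) (x i) (m' ⟨i, h⟩) else g i := fun i => congrFun h i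
  refine Prod.ext (funext fun i => ?_) (funext fun i => ?_)
  · by_cases hA : i ∈ A
    · have h1 := hi i
      rw [dif_pos hA, dif_pos hA] at h1
      have h2 : ∀ z, z ≠ x i → f i z = g i z := fun z hz => by
        simpa [Function.update_of_ne hz] using congrFun h1 z
      funext z
      by_cases hz : z = x i
      · rw [hz]
        change f i (x i) = g i (x i)
        rw [← hf i hA, ← hg i hA]
        exact h2 _ (hxy i hA)
      · exact h2 z hz
    · have h1 := hi i
      rwa [dif_neg hA, dif_neg hA] at h1
  · have h1 := hi i.1
    rw [dif_pos i.2, dif_pos i.2] at h1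
    simpa using congrFun h1 (x i.1)

variable {𝒳 : Fin 3 → Type*} {n : ℕ} {M : Fin 3 → ℕ}

/-- Some block of `T` differs from `s` precisely in the coordinates in `A`, and has the same bin
indices as `s`. -/
def Confusable (f : ∀ i, (Fin n → 𝒳 i) → Fin (M i)) (A : Finset (Fin 3))
    (T : Set (Fin n → ∀ i, 𝒳 i)) (s : Fin n → ∀ i, 𝒳 i) : Prop :=
  ∃ s' ∈ T, AgreeOff A s s' ∧ (∀ j ∈ A, (fun t => s' t j) ≠ fun t => s t j) ∧
    ∀ j ∈ A, f j (fun t => s' t j) = f j (fun t => s t j)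

variable [∀ i, Fintype (𝒳 i)] {p : (∀ i, 𝒳 i) → ℝ}

open Classical in
theorem card_confusable_le (hp : ∀ a, 0 ≤ p a) (hM : ∀ i, 0 < M i) (A : Finset (Fin 3))
    (s : Fin n → ∀ i, 𝒳 i) {θ : ℝ} (hθ : 0 < θ) :
    ((Finset.univ.filter fun f : ∀ i, (Fin n → 𝒳 i) → Fin (M i) =>
      Confusable f A {s | θ ≤ blockRatio p A s} s).card : ℝ) ≤
      Fintype.card (∀ i, (Fin n → 𝒳 i) → Fin (M i)) * (θ⁻¹ / ∏ i ∈ A, (M i : ℝ)) := by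
  set N := Fintype.card (∀ i, (Fin n → 𝒳 i) → Fin (M i))
  have hpos : 0 < ∏ i ∈ A, (M i : ℝ) := Finset.prod_pos fun i _ => by exact_mod_cast hM i
  set S := Finset.univ.filter fun s' => AgreeOff A s s' ∧ θ ≤ blockRatio p A s'
  let Cf : (Fin n → ∀ i, 𝒳 i) → Finset (∀ i, (Fin n → 𝒳 i) → Fin (M i)) := fun s' =>
    Finset.univ.filter fun f => (∀ j ∈ A, (fun t => s' t j) ≠ fun t => s t j) ∧
      ∀ j ∈ A, f j (fun t => s' t j) = f j (fun t => s t j)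
  have h1 : ∀ s', ((Cf s').card : ℝ) ≤ N / ∏ i ∈ A, (M i : ℝ) := by
    intro s'
    rw [le_div_iff₀ hpos]
    by_cases hd : ∀ j ∈ A, (fun t => s' t j) ≠ fun t => s t j
    · have := card_collision_mul_le M A (fun j t => s t j) (fun j t => s' t j) hd
      have h2 : Cf s' = Finset.univ.filter fun f : ∀ i, (Fin n → 𝒳 i) → Fin (M i) =>
          ∀ j ∈ A, f j (fun t => s' t j) = f j (fun t => s t j) :=
        Finset.filter_congr fun f _ => and_iff_right hd
      have h3 : (Cf s').card * ∏ i ∈ A, M i ≤ N := by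
        rw [h2]
        convert this
      exact_mod_cast h3
    · have h2 : Cf s' = ∅ := Finset.filter_eq_empty_iff.2 fun f _ h => hd h.1
      rw [h2]
      simp
  have h2 : (Finset.univ.filter fun f : ∀ i, (Fin n → 𝒳 i) → Fin (M i) =>
      Confusable f A {s | θ ≤ blockRatio p A s} s) ⊆ S.biUnion Cf := by
    intro f hf
    obtain ⟨s', hT, hag, hd⟩ := (Finset.mem_filter.1 hf).2
    exact Finset.mem_biUnion.2 ⟨s', Finset.mem_filter.2 ⟨Finset.mem_univ _, hag, hT⟩,
      Finset.mem_filter.2 ⟨Finset.mem_univ _, hd⟩⟩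
  calc _ ≤ ((S.biUnion Cf).card : ℝ) := by exact_mod_cast Finset.card_le_card h2
    _ ≤ ∑ s' ∈ S, ((Cf s').card : ℝ) := by exact_mod_cast Finset.card_biUnion_le
    _ ≤ ∑ s' ∈ S, (N / ∏ i ∈ A, (M i : ℝ)) := Finset.sum_le_sum fun s' _ => h1 s'
    _ = S.card * (N / ∏ i ∈ A, (M i : ℝ)) := by rw [Finset.sum_const, nsmul_eq_mul]
    _ ≤ θ⁻¹ * (N / ∏ i ∈ A, (M i : ℝ)) := by
      gcongr
      exact card_blockRatio_ge_le hp A s hθ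
    _ = _ := by ring

/-- First moment method: the bound holds for the average over all `f`, by exchanging the sums over
`f` and `s`. -/
theorem exists_binning (hp : p ∈ stdSimplex ℝ (∀ i, 𝒳 i)) (hM : ∀ i, 0 < M i)
    (S : Finset (Finset (Fin 3))) {θ : Finset (Fin 3) → ℝ} (hθ : ∀ A, 0 < θ A) :
    ∃ f : ∀ i, (Fin n → 𝒳 i) → Fin (M i),
      prob (iidLaw p n) {s | ∃ A ∈ S, Confusable f A {s | θ A ≤ blockRatio p A s} s} ≤
        ∑ A ∈ S, (θ A)⁻¹ / ∏ i ∈ A, (M i : ℝ) := by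
  classical
  have hP := iidLaw_nonneg hp.1 n
  have : Nonempty (∀ i, (Fin n → 𝒳 i) → Fin (M i)) := ⟨fun i _ => ⟨0, hM i⟩⟩
  obtain ⟨f, -, hf⟩ := Finset.exists_le_of_sum_le
    (s := (Finset.univ : Finset (∀ i, (Fin n → 𝒳 i) → Fin (M i))))
    (f := fun f => ∑ A ∈ S,
      prob (iidLaw p n) {s | Confusable f A {s | θ A ≤ blockRatio p A s} s})
    (g := fun _ => ∑ A ∈ S, (θ A)⁻¹ / ∏ i ∈ A, (M i : ℝ)) Finset.univ_nonempty (by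
      rw [Finset.sum_comm, Finset.sum_const, nsmul_eq_mul, Finset.mul_sum]
      refine Finset.sum_le_sum fun A _ => ?_
      unfold prob
      rw [Finset.sum_comm]
      set B := Fintype.card (∀ i, (Fin n → 𝒳 i) → Fin (M i)) * ((θ A)⁻¹ / ∏ i ∈ A, (M i : ℝ))
        with hB
      calc _ ≤ ∑ s, iidLaw p n s * B := by
            refine Finset.sum_le_sum fun s _ => ?_
            have h1 := card_confusable_le hp.1 hM A s (hθ A)
            refine le_trans (le_of_eq ?_) (mul_le_mul_of_nonneg_left h1 (hP s))
            rw [mul_comm, ← nsmul_eq_mul, ← Finset.sum_const, Finset.sum_filter]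
            refine Finset.sum_congr rfl fun f _ => ?_
            simp [Set.indicator_apply]
        _ = B := by rw [← Finset.sum_mul, sum_iidLaw hp.2, one_mul]
        _ = _ := by rw [hB, Finset.card_univ])
  refine ⟨f, le_trans ?_ hf⟩
  refine le_trans (prob_mono hP fun s hs => ?_) (prob_biUnion_le hP S _)
  obtain ⟨A, hA, h⟩ := hs
  simp only [mem_iUnion]
  exact ⟨A, hA, h⟩

/-- The code that bins with `f`, and decodes to a block in `T` that fits the observations. -/
def binningCode [∀ i, Nonempty (𝒳 i)] (f : ∀ i, (Fin n → 𝒳 i) → Fin (M i))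
    (T : Set (Fin n → ∀ i, 𝒳 i)) : SWCode 𝒳 n where
  size := M
  enc := f
  dec i j _ x m := fun t => Classical.epsilon (fun s' : Fin n → ∀ i, 𝒳 i => s' ∈ T ∧
    (fun t => s' t i) = x ∧ ∀ k : {k // k ≠ i}, f k.1 (fun t => s' t k.1) = m k) t j

/-- The sets of coordinates in which a decoder can be wrong. -/
def properSets : Finset (Finset (Fin 3)) :=
  Finset.univ.filter fun A => A.Nonempty ∧ A ≠ Finset.univ

/-- If the true block lies in `T`, the decoder's choice also fits the observations; the set `A`
where the two differ omits `i` and, after an error, contains `j`, so it is a proper set witnessing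
confusion. -/
theorem binningCode_errProb_le [∀ i, Nonempty (𝒳 i)] (hp : p ∈ stdSimplex ℝ (∀ i, 𝒳 i))
    (f : ∀ i, (Fin n → 𝒳 i) → Fin (M i)) (θ : Finset (Fin 3) → ℝ) (i j : Fin 3) (h : i ≠ j) :
    (binningCode f {s | ∀ A ∈ properSets, θ A ≤ blockRatio p A s}).errProb p i j h ≤
      ∑ A ∈ properSets, prob (iidLaw p n) {s | blockRatio p A s < θ A} +
      prob (iidLaw p n)
        {s | ∃ A ∈ properSets, Confusable f A {s | θ A ≤ blockRatio p A s} s} := by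
  classical
  have hP := iidLaw_nonneg hp.1 n
  set T : Set (Fin n → ∀ i, 𝒳 i) := {s | ∀ A ∈ properSets, θ A ≤ blockRatio p A s} with hT
  have key : ∀ s, (binningCode f T).recon s i j h ≠ (fun t => s t j) → s ∈ T →
      ∃ A ∈ properSets, Confusable f A {s | θ A ≤ blockRatio p A s} s := by
    intro s hs hsT
    set Q : (Fin n → ∀ i, 𝒳 i) → Prop := fun s' => s' ∈ T ∧
      (fun t => s' t i) = (fun t => s t i) ∧
      ∀ k : {k // k ≠ i}, f k.1 (fun t => s' t k.1) = f k.1 (fun t => s t k.1) with hQ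
    obtain ⟨h1, h2, h3⟩ : Q (Classical.epsilon Q) :=
      Classical.epsilon_spec ⟨s, hsT, rfl, fun _ => rfl⟩
    set s' := Classical.epsilon Q
    have hrec : (binningCode f T).recon s i j h = fun t => s' t j := rfl
    rw [hrec] at hs
    set A : Finset (Fin 3) := Finset.univ.filter fun k => (fun t => s' t k) ≠ fun t => s t k
      with hA
    have hmem : ∀ k, k ∈ A ↔ (fun t => s' t k) ≠ fun t => s t k := by simp [hA]
    have hiA : i ∉ A := fun hi => (hmem i).1 hi h2
    have hAS : A ∈ properSets := Finset.mem_filter.2 ⟨Finset.mem_univ _, ⟨j, (hmem j).2 hs⟩,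
      fun he => hiA (he ▸ Finset.mem_univ i)⟩
    refine ⟨A, hAS, s', h1 A hAS, fun t k hk => ?_, fun k hk => (hmem k).1 hk, fun k hk => ?_⟩
    · rw [hmem, not_not] at hk
      exact congrFun hk t
    · exact h3 ⟨k, fun e => hiA (e ▸ hk)⟩
  refine le_trans (prob_mono hP (F := (⋃ A ∈ properSets, {s | blockRatio p A s < θ A}) ∪
    {s | ∃ A ∈ properSets, Confusable f A {s | θ A ≤ blockRatio p A s} s}) fun s hs => ?_)
    ((prob_union_le hP _ _).trans (add_le_add_left (prob_biUnion_le hP _ _) _))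
  by_cases hsT : s ∈ T
  · exact Or.inr (key s hs hsT)
  · left
    simp only [hT, mem_ofPred_eq, not_forall, not_le] at hsT
    obtain ⟨A, hA, hlt⟩ := hsT
    simp only [mem_iUnion]
    exact ⟨A, hA, hlt⟩

theorem half_le_natFloor {x : ℝ} (hx : 1 ≤ x) : x / 2 ≤ (⌊x⌋₊ : ℝ) := by
  have h1 : (1 : ℝ) ≤ (⌊x⌋₊ : ℝ) := by exact_mod_cast Nat.one_le_floor_iff x |>.2 hx
  have h2 := Nat.lt_floor_add_one x
  linarith

theorem mem_nonInteractiveRegion (hp : p ∈ stdSimplex ℝ (∀ i, 𝒳 i)) {R : Fin 3 → ℝ}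
    (hR : ∀ A ∈ properSets, setEntropy p A ≤ ∑ i ∈ A, R i) : R ∈ nonInteractiveRegion p := by
  intro ε hε
  obtain ⟨a₀⟩ : Nonempty (∀ i, 𝒳 i) := by
    by_contra h
    rw [not_nonempty_iff] at h
    simpa using hp.2
  have : ∀ i, Nonempty (𝒳 i) := fun i => ⟨a₀ i⟩
  -- Nonnegative rates make `2 ^ (n * (R i + ε))` at least `1`, so rounding it down costs at most a
  -- factor `2`.
  have hR0 : ∀ i, 0 ≤ R i := by
    intro i
    have hi : ({i} : Finset (Fin 3)) ∈ properSets := by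
      refine Finset.mem_filter.2 ⟨Finset.mem_univ _, Finset.singleton_nonempty i, fun h => ?_⟩
      simpa using congrArg Finset.card h
    simpa using (setEntropy_nonneg hp.1 _).trans (hR _ hi)
  choose C hC using fun A => prob_blockRatio_deviation hp A (half_pos hε)
  -- The factor `8 = 2 ^ 3` pays for rounding at most three bin counts; `ε / 2` is the gap between
  -- the rate slack `ε` and the slack `ε / 2` in the threshold `θ`.
  have hlim : Filter.Tendsto (fun n : ℕ => ∑ A ∈ properSets, C A / n +
      ∑ A ∈ properSets, 8 * (2 : ℝ) ^ (-(n * (ε / 2)))) Filter.atTop (nhds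
        (∑ A ∈ properSets, 0 + ∑ A ∈ properSets, 8 * 0)) :=
    (tendsto_finsetSum _ fun A _ => tendsto_const_div_atTop_nhds_zero_nat (C A)).add
      (tendsto_finsetSum _ fun A _ =>
        (tendsto_rpow_neg_mul_natCast (half_pos hε)).const_mul 8)
  simp only [mul_zero, Finset.sum_const_zero, add_zero] at hlim
  obtain ⟨n₀, hn₀⟩ := Filter.eventually_atTop.1 (hlim.eventually (gt_mem_nhds hε))
  refine ⟨n₀, fun n hn => ?_⟩
  have hnpos : 0 < n := (Nat.zero_le _).trans_lt hn
  have hn' : (0 : ℝ) < n := by exact_mod_cast hnpos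
  set M : Fin 3 → ℕ := fun i => ⌊(2 : ℝ) ^ (n * (R i + ε))⌋₊ with hM
  have hx : ∀ i, 1 ≤ (2 : ℝ) ^ (n * (R i + ε)) := fun i => by
    have := hR0 i
    exact Real.one_le_rpow one_le_two (by positivity)
  have hMpos : ∀ i, 0 < M i := fun i => Nat.floor_pos.2 (hx i)
  set θ : Finset (Fin 3) → ℝ := fun A => (2 : ℝ) ^ (-(n * (setEntropy p A + ε / 2))) with hθ
  obtain ⟨f, hf⟩ := exists_binning (n := n) hp hMpos properSets (θ := θ) fun A => by positivity
  refine ⟨binningCode f {s | ∀ A ∈ properSets, θ A ≤ blockRatio p A s}, fun i => ?_,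
    fun i j h => ?_⟩
  · change 1 / (n : ℝ) * Real.logb 2 (M i) ≤ _
    have h1 : Real.logb 2 (M i) ≤ n * (R i + ε) := by
      rw [Real.logb_le_iff_le_rpow one_lt_two (by exact_mod_cast hMpos i)]
      exact Nat.floor_le (by positivity)
    calc 1 / (n : ℝ) * Real.logb 2 (M i) ≤ 1 / (n : ℝ) * (n * (R i + ε)) := by gcongr
      _ = R i + ε := by field_simp
  · refine (binningCode_errProb_le hp f θ i j h).trans
      (le_trans (add_le_add ?_ (hf.trans ?_)) (hn₀ n hn.le).le)
    · exact Finset.sum_le_sum fun A _ => (hC A n hnpos).1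
    · refine Finset.sum_le_sum fun A hA => ?_
      have hcard : A.card ≤ 3 := (Finset.card_le_univ A).trans (by simp)
      have hcard1 : (1 : ℝ) ≤ A.card := by
        exact_mod_cast Finset.card_pos.2 (Finset.mem_filter.1 hA).2.1
      have h1 : (2 : ℝ) ^ (n * (setEntropy p A + ε)) / 8 ≤ ∏ i ∈ A, (M i : ℝ) := by
        calc (2 : ℝ) ^ (n * (setEntropy p A + ε)) / 8
            ≤ (2 : ℝ) ^ (n * ∑ i ∈ A, (R i + ε)) / 2 ^ A.card := by
              have h8 : (2 : ℝ) ^ A.card ≤ 8 :=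
                (pow_le_pow_right₀ one_le_two hcard).trans (by norm_num)
              have hsum : setEntropy p A + ε ≤ ∑ i ∈ A, (R i + ε) := by
                rw [Finset.sum_add_distrib, Finset.sum_const, nsmul_eq_mul]
                have := hR A hA
                nlinarith
              gcongr
              exact one_le_two
          _ = ∏ i ∈ A, ((2 : ℝ) ^ (n * (R i + ε)) / 2) := by
              rw [Finset.prod_div_distrib, Finset.prod_const, Finset.mul_sum,
                Real.rpow_sum_of_pos two_pos]
          _ ≤ _ := Finset.prod_le_prod (fun i _ => by positivity)
              fun i _ => half_le_natFloor (hx i)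
      calc (θ A)⁻¹ / ∏ i ∈ A, (M i : ℝ)
          ≤ (θ A)⁻¹ / ((2 : ℝ) ^ (n * (setEntropy p A + ε)) / 8) := by gcongr
        _ = 8 * ((2 : ℝ) ^ (n * (setEntropy p A + ε / 2)) /
              (2 : ℝ) ^ (n * (setEntropy p A + ε))) := by
            rw [hθ]
            simp only [Real.rpow_neg two_pos.le, inv_inv]
            field_simp
        _ = _ := by
            rw [← Real.rpow_sub two_pos]
            ring_nf

end Binning

/-! ### Comparison of the regions -/

section Region

variable {𝒳 : Fin 3 → Type*}

/-- The sizes of the message sets, if a single message from a set of size `m` is sent in the first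
round. -/
def firstRoundSize (m : ℕ) {K : ℕ} : Fin (K + 1) → ℕ
  | ⟨0, _⟩ => m
  | ⟨_ + 1, _⟩ => 1

/-- The messages, if the single message `x` is sent in the first round. -/
def firstRoundMsg {m : ℕ} (x : Fin m) {K : ℕ} : ∀ l : Fin (K + 1), Fin (firstRoundSize m l)
  | ⟨0, _⟩ => x
  | ⟨_ + 1, _⟩ => (0 : Fin 1)

/-- A code without interaction as a code with `K + 1` rounds, all messages being trivial after the
first round. -/
def SWCode.toCode {n : ℕ} (c : SWCode 𝒳 n) (σ : Equiv.Perm (Fin 3)) (K : ℕ) :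
    Code σ 𝒳 n (K + 1) where
  size i := firstRoundSize (c.size i)
  enc i l x _ := firstRoundMsg (c.enc i x) l
  dec i j h x m := c.dec i j h x fun k => m ⟨(k.1, ⟨0, K.succ_pos⟩), k.2⟩

theorem SWCode.toCode_rate {n : ℕ} (c : SWCode 𝒳 n) (σ : Equiv.Perm (Fin 3)) (K : ℕ)
    (i : Fin 3) : (c.toCode σ K).rate i = c.rate i := by
  have h0 : (c.toCode σ K).size i 0 = c.size i := rfl
  have h1 : ∀ l : Fin K, (c.toCode σ K).size i l.succ = 1 := fun _ => rfl
  simp [Code.rate, SWCode.rate, Fin.sum_univ_succ, h0, h1]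

theorem SWCode.toCode_recon {n : ℕ} (c : SWCode 𝒳 n) (σ : Equiv.Perm (Fin 3)) (K : ℕ)
    (s : Fin n → ∀ i, 𝒳 i) (i j : Fin 3) (h : i ≠ j) :
    (c.toCode σ K).recon s i j h = c.recon s i j h := by
  have hm : ∀ i, (c.toCode σ K).msg s i ⟨0, K.succ_pos⟩ = c.enc i fun t => s t i := fun i => by
    rw [Code.msg]
    rfl
  change c.dec i j h _ (fun k => (c.toCode σ K).msg s k.1 ⟨0, K.succ_pos⟩) = _
  rw [funext fun k : {k // k ≠ i} => hm k.1]
  rfl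

variable [∀ i, Fintype (𝒳 i)] {p : (∀ i, 𝒳 i) → ℝ}

theorem nonInteractiveRegion_subset (σ : Equiv.Perm (Fin 3)) (p : (∀ i, 𝒳 i) → ℝ) {K : ℕ}
    (hK : 1 ≤ K) : nonInteractiveRegion p ⊆ interactiveRegion σ p K := by
  obtain ⟨K, rfl⟩ := Nat.exists_eq_add_of_le' hK
  intro R hR ε hε
  obtain ⟨n₀, hn₀⟩ := hR ε hε
  refine ⟨n₀, fun n hn => ?_⟩
  obtain ⟨c, hr, he⟩ := hn₀ n hn
  refine ⟨c.toCode σ K, fun i => (c.toCode_rate σ K i).trans_le (hr i), fun i j h => ?_⟩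
  have := he i j h
  unfold SWCode.errProb at this
  unfold Code.errProb
  simpa only [SWCode.toCode_recon] using this

/-- `U` and `V` together determine the point, so the joint event is a singleton. -/
theorem condEntropy_eq_setEntropy {β γ : Type*} (p : (∀ i, 𝒳 i) → ℝ) {U : (∀ i, 𝒳 i) → β}
    {V : (∀ i, 𝒳 i) → γ} (A : Finset (Fin 3))
    (hU : ∀ a b, U b = U a ↔ ∀ i ∈ A, b i = a i)
    (hV : ∀ a b, V b = V a ↔ ∀ i ∉ A, b i = a i) : condEntropy p U V = setEntropy p A := by
  classical
  refine Finset.sum_congr rfl fun a _ => ?_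
  have h1 : {b | U b = U a ∧ V b = V a} = {a} := by
    ext b
    simp only [mem_ofPred_eq, hU, hV, mem_singleton_iff]
    constructor
    · rintro ⟨h, h'⟩
      funext i
      by_cases hi : i ∈ A
      exacts [h i hi, h' i hi]
    · rintro rfl
      simp
  have h2 : {b | V b = V a} = {b | ∀ i ∉ A, b i = a i} := by
    ext b
    exact hV a b
  have h3 : prob p {a} = p a := by simp [prob, Set.indicator_apply]
  rw [h1, h2, h3]
  rfl

/-- Raising all rates by the same `x > 0` makes every inequality strict, as each `S k` is nonempty;
then `x` tends to `0`. -/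
theorem setOf_subset_closure_setOf_lt {κ : Type*} (S : κ → Finset (Fin 3))
    (hS : ∀ k, (S k).Nonempty) (H : κ → ℝ) :
    {R : Fin 3 → ℝ | ∀ k, H k ≤ ∑ i ∈ S k, R i} ⊆
      closure {R | ∀ k, H k < ∑ i ∈ S k, R i} := by
  intro R hR
  have hlim : Filter.Tendsto (fun x : ℝ => fun i => R i + x) (nhdsWithin 0 (Ioi 0)) (nhds R) := by
    have : Continuous fun x : ℝ => fun i => R i + x := by fun_prop
    simpa using (this.tendsto 0).mono_left nhdsWithin_le_nhds
  refine mem_closure_of_tendsto hlim (Filter.eventually_of_mem self_mem_nhdsWithin fun x hx k => ?_)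
  have hx : 0 < x := hx
  have : (0 : ℝ) < (S k).card := by exact_mod_cast (hS k).card_pos
  have h1 : H k ≤ ∑ i ∈ S k, R i := hR k
  rw [Finset.sum_add_distrib, Finset.sum_const, nsmul_eq_mul]
  have := mul_pos this hx
  linarith

theorem closure_setOf_lt {κ : Type*} (S : κ → Finset (Fin 3)) (hS : ∀ k, (S k).Nonempty)
    (H : κ → ℝ) : closure {R : Fin 3 → ℝ | ∀ k, H k < ∑ i ∈ S k, R i} =
      {R | ∀ k, H k ≤ ∑ i ∈ S k, R i} := by
  refine (closure_minimal (fun R hR k => (hR k).le) ?_).antisymm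
    (setOf_subset_closure_setOf_lt S hS H)
  simp only [Set.ofPred_forall]
  exact isClosed_iInter fun k => isClosed_le (by fun_prop) (by fun_prop)

theorem interactiveRegion_eq (hp : p ∈ stdSimplex ℝ (∀ i, 𝒳 i)) (σ : Equiv.Perm (Fin 3))
    {K : ℕ} (hK : 1 ≤ K) :
    interactiveRegion σ p K = {R | ∀ A : properSets, setEntropy p A ≤ ∑ i ∈ A.1, R i} ∧
      interactiveRegion σ p K = nonInteractiveRegion p := by
  have h1 : interactiveRegion σ p K ⊆ {R | ∀ A : properSets, setEntropy p A ≤ ∑ i ∈ A.1, R i} :=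
    fun R hR A => setEntropy_le_of_mem_interactiveRegion hp hR (Finset.mem_filter.1 A.2).2.2
  have h2 : {R | ∀ A : properSets, setEntropy p A ≤ ∑ i ∈ A.1, R i} ⊆ nonInteractiveRegion p :=
    fun R hR => mem_nonInteractiveRegion hp fun A hA => hR ⟨A, hA⟩
  have h3 := nonInteractiveRegion_subset σ p hK
  exact ⟨h1.antisymm (h2.trans h3), (h1.trans h2).antisymm h3⟩

theorem forall_properSets {P : Finset (Fin 3) → Prop} :
    (∀ A : properSets, P A) ↔ P {0} ∧ P {1} ∧ P {2} ∧ P {0, 1} ∧ P {0, 2} ∧ P {1, 2} := by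
  have h : properSets = {{0}, {1}, {2}, {0, 1}, {0, 2}, {1, 2}} := by decide
  rw [Subtype.forall, h]
  simp

end Region

end InteractiveLossless

end

open InteractiveLossless in
theorem theorem8 (𝒳 : Fin 3 → Type*) [∀ i, Fintype (𝒳 i)] (p : (∀ i, 𝒳 i) → ℝ)
    (hp : p ∈ stdSimplex ℝ (∀ i, 𝒳 i)) :
    (∀ (σ : Equiv.Perm (Fin 3)) (K : ℕ), 1 ≤ K →
      interactiveRegion σ p K =
        {R : Fin 3 → ℝ |
          R 0 ≥ condEntropy p (fun x => x 0) (fun x => (x 1, x 2)) ∧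
          R 1 ≥ condEntropy p (fun x => x 1) (fun x => (x 0, x 2)) ∧
          R 2 ≥ condEntropy p (fun x => x 2) (fun x => (x 0, x 1)) ∧
          R 0 + R 1 ≥ condEntropy p (fun x => (x 0, x 1)) (fun x => x 2) ∧
          R 0 + R 2 ≥ condEntropy p (fun x => (x 0, x 2)) (fun x => x 1) ∧
          R 1 + R 2 ≥ condEntropy p (fun x => (x 1, x 2)) (fun x => x 0)} ∧
      interactiveRegion σ p K =
        closure {R : Fin 3 → ℝ |
          R 0 > condEntropy p (fun x => x 0) (fun x => (x 1, x 2)) ∧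
          R 1 > condEntropy p (fun x => x 1) (fun x => (x 0, x 2)) ∧
          R 2 > condEntropy p (fun x => x 2) (fun x => (x 0, x 1)) ∧
          R 0 + R 1 > condEntropy p (fun x => (x 0, x 1)) (fun x => x 2) ∧
          R 0 + R 2 > condEntropy p (fun x => (x 0, x 2)) (fun x => x 1) ∧
          R 1 + R 2 > condEntropy p (fun x => (x 1, x 2)) (fun x => x 0)} ∧
      interactiveRegion σ p K = nonInteractiveRegion p) := by
  have e0 : condEntropy p (fun x => x 0) (fun x => (x 1, x 2)) = setEntropy p {0} :=
    condEntropy_eq_setEntropy p _ (by simp) (by simp [Fin.forall_fin_succ])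
  have e1 : condEntropy p (fun x => x 1) (fun x => (x 0, x 2)) = setEntropy p {1} :=
    condEntropy_eq_setEntropy p _ (by simp) (by simp [Fin.forall_fin_succ])
  have e2 : condEntropy p (fun x => x 2) (fun x => (x 0, x 1)) = setEntropy p {2} :=
    condEntropy_eq_setEntropy p _ (by simp) (by simp [Fin.forall_fin_succ])
  have e01 : condEntropy p (fun x => (x 0, x 1)) (fun x => x 2) = setEntropy p {0, 1} :=
    condEntropy_eq_setEntropy p _ (by simp) (by simp [Fin.forall_fin_succ])
  have e02 : condEntropy p (fun x => (x 0, x 2)) (fun x => x 1) = setEntropy p {0, 2} :=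
    condEntropy_eq_setEntropy p _ (by simp) (by simp [Fin.forall_fin_succ])
  have e12 : condEntropy p (fun x => (x 1, x 2)) (fun x => x 0) = setEntropy p {1, 2} :=
    condEntropy_eq_setEntropy p _ (by simp) (by simp [Fin.forall_fin_succ])
  intro σ K hK
  obtain ⟨h1, h2⟩ := interactiveRegion_eq hp σ hK
  refine ⟨?_, ?_, h2⟩
  · rw [h1, e0, e1, e2, e01, e02, e12]
    ext R
    rw [mem_ofPred_eq, mem_ofPred_eq,
      forall_properSets (P := fun A => setEntropy p A ≤ ∑ i ∈ A, R i)]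
    simp
  · rw [h1, ← closure_setOf_lt (fun A : properSets => A.1)
      (fun A => (Finset.mem_filter.1 A.2).2.1) (fun A => setEntropy p A.1),
      e0, e1, e2, e01, e02, e12]
    congr 1
    ext R
    rw [mem_ofPred_eq, mem_ofPred_eq,
      forall_properSets (P := fun A => setEntropy p A < ∑ i ∈ A, R i)]
    simp
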